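/- Let $d\in\{2,3\}$, let $\Omega\subset\mathbb R^d$ be a bounded polygonal ($d=2$) or polyhedral ($d=3$) domain, and let $\mathcal T_h$ be a conforming triangulation (no hanging nodes) of $\Omega$ into $d$-simplices $T$. Call $\mathcal T_h$ shape regular with constant $\sigma$ if every $T\in\mathcal T_h$ contains a closed ball of some radius $r>0$ with $\operatorname{diam}T\le\sigma r$. Let $\mathcal E_h$ be the set of all $(d-1)$-dimensional faces (edges if $d=2$), both interior and boundary ones, and let $h_e$ be the diameter of $e\in\mathcal E_h$. Let $\kappa$ be a positive function that is constant, $\kappa=\kappa_T$, on each $T\in\mathcal T_h$. Let $V_h^{DG}=\{v\in L^2(\Omega): v|_T\in\mathbb P^1(T)\ \ \forall\, T\in\mathcal T_h\}$. On an interior face $e=\partial T^+\cap\partial T^-$ with outward unit normals $n^\pm$ and $\kappa^\pm=\kappa_{T^\pm}$, put $$[\![v]\!]=v^+n^++v^-n^-,\qquad \{\kappa\nabla v\}_{\beta_e}=\beta_e\,\kappa^+(\nabla v)^++(1-\beta_e)\,\kappa^-(\nabla v)^-,$$ $$\beta_e=\frac{\kappa^-}{\kappa^++\kappa^-},\qquad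 \kappa_e=\frac{2\kappa^+\kappa^-}{\kappa^++\kappa^-}.$$ On a boundary face $e\subset\partial T\cap\partial\Omega$, put $[\![v]\!]=vn$, $\{\kappa\nabla v\}_{\beta_e}=\kappa\nabla v$ and $\kappa_e=\kappa_T$. Let $\mathcal P^0_e$ be the $L^2(e)$-projection onto constants. For $\alpha>0$, $\theta\in\{-1,0,1\}$ and $v,w\in V_h^{DG}$ let $$\mathcal A(v,w)=\sum_{T\in\mathcal T_h}\int_T\kappa\nabla v\cdot\nabla w\,dx-\sum_{e\in\mathcal E_h}\int_e\{\kappa\nabla v\}_{\beta_e}\cdot[\![w]\!]\,ds+\theta\sum_{e\in\mathcal E_h}\int_e[\![v]\!]\cdot\{\kappa\nabla w\}_{\beta_e}\,ds+\sum_{e\in\mathcal E_h}\int_e\alpha h_e^{-1}\kappa_e\,[\![v]\!]\cdot[\![w]\!]\,ds,$$ and let $\mathcal A_0(v,w)$ be given by the same formula with $[\![v]\!]$ replaced by $\mathcal P^0_e([\![v]\!])$ in the last sum only. Then for every $\sigma$ there is a threshold $\alpha_0$, depending only on $\sigma$, and for every $\alpha>0$ there is a constant $c_0>0$, depending only on $\sigma$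 and $\alpha$ (in particular neither on $\kappa$ nor on the mesh size), such that for all $d$, $\Omega$, $\kappa$, $\theta$ as above, every $\mathcal T_h$ that is shape regular with constant $\sigma$, and every $v\in V_h^{DG}$: $$\mathcal A_0(v,v)\le\mathcal A(v,v),$$ and, if $\theta=1$ or $\alpha\ge\alpha_0$, $$\mathcal A(v,v)\le c_0\,\mathcal A_0(v,v).$$ -/

import Mathlib

open MeasureTheory
open scoped RealInnerProductSpace BigOperators

noncomputable section

namespace IPDG

/-- A conforming (no hanging nodes) triangulation of a bounded polygonal / polyhedral domain `Ω`
of `ℝ^d`: a finite simplicial complex all of whose maximal simplices are `d`-dimensional and whose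
underlying space is the closure of `Ω`. Simplices are recorded by their finite sets of vertices. -/
structure SimplicialMesh (d : ℕ) (Ω : Set (EuclideanSpace ℝ (Fin d))) extends
    Geometry.SimplicialComplex ℝ (EuclideanSpace ℝ (Fin d)) where
  finite_faces : faces.Finite
  exists_element : ∀ s ∈ faces, ∃ T ∈ faces, s ⊆ T ∧ T.card = d + 1
  space_eq : toSimplicialComplex.space = closure Ω

namespace SimplicialMesh

variable {d : ℕ} {Ω : Set (EuclideanSpace ℝ (Fin d))} (M : SimplicialMesh d Ω)

/-- The elements of the mesh (triangles if `d = 2`, tetrahedra if `d = 3`). -/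
abbrev Element : Type := {T : Finset (EuclideanSpace ℝ (Fin d)) // T ∈ M.faces ∧ T.card = d + 1}

/-- The `(d-1)`-dimensional faces (edges if `d = 2`) of the mesh, interior and boundary ones. -/
abbrev Face : Type := {e : Finset (EuclideanSpace ℝ (Fin d)) // e ∈ M.faces ∧ e.card = d}

instance : Fintype M.Element := (M.finite_faces.subset fun _ hs => hs.1).fintype

instance : Fintype M.Face := (M.finite_faces.subset fun _ hs => hs.1).fintype

variable {M}

/-- The closed simplex occupied by an element. -/
def Element.carrier (T : M.Element) : Set (EuclideanSpace ℝ (Fin d)) :=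
  convexHull ℝ (T.1 : Set (EuclideanSpace ℝ (Fin d)))

/-- The closed `(d-1)`-simplex occupied by a face. -/
def Face.carrier (e : M.Face) : Set (EuclideanSpace ℝ (Fin d)) :=
  convexHull ℝ (e.1 : Set (EuclideanSpace ℝ (Fin d)))

/-- The surface measure on a face: `(d-1)`-dimensional Hausdorff measure, normalized to agree
with Lebesgue measure on `(d-1)`-dimensional affine subspaces. -/
def Face.measure (e : M.Face) : Measure (EuclideanSpace ℝ (Fin d)) :=
  μHE[d - 1].restrict e.carrier

/-- The size `h_e` of a face: its diameter (which is the length of `e` if `d = 2`). -/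
def Face.size (e : M.Face) : ℝ := Metric.diam e.carrier

open Classical in
/-- The elements having `e` as a face: two (`T⁺` and `T⁻`) for an interior face, one for a
boundary face. -/
def Face.neighbors (e : M.Face) : Finset M.Element := {T | e.1 ⊆ T.1}

/-- Boundary faces are those which belong to a single element. -/
def Face.IsBoundary (e : M.Face) : Prop := e.neighbors.card = 1

/-- The unit normal `n_T` on the face `e` of `T`, pointing out of `T`: the normalized component
orthogonal to `e` of the vector joining the barycenter of `T` to the barycenter of `e`. -/
def outwardNormal (T : M.Element) (e : M.Face) : EuclideanSpace ℝ (Fin d) :=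
  NormedSpace.normalize
    ((vectorSpan ℝ (e.1 : Set (EuclideanSpace ℝ (Fin d))))ᗮ.starProjection
      (e.1.centroid ℝ id - T.1.centroid ℝ id))

variable (M) in
/-- Shape regularity with constant `σ`: every element `T` contains a ball of radius `r` with
`diam T ≤ σ r`. -/
def IsShapeRegular (σ : ℝ) : Prop :=
  ∀ T : M.Element, ∃ x : EuclideanSpace ℝ (Fin d), ∃ r : ℝ, 0 < r ∧
    Metric.closedBall x r ⊆ T.carrier ∧ Metric.diam T.carrier ≤ σ * r

variable (M) in
/-- The discontinuous piecewise linear space `V_h^DG = ∏_T P¹(T)`: one affine function for each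
element, with no continuity between elements. -/
abbrev DGSpace : Type := M.Element → (EuclideanSpace ℝ (Fin d) →ᵃ[ℝ] ℝ)

/-- The jump `⟦v⟧ = v⁺ n⁺ + v⁻ n⁻` on an interior face, `⟦v⟧ = v n` on a boundary face. -/
def jump (v : M.DGSpace) (e : M.Face) (x : EuclideanSpace ℝ (Fin d)) :
    EuclideanSpace ℝ (Fin d) :=
  ∑ T ∈ e.neighbors, v T x • outwardNormal T e

open Classical in
/-- The weight carried by the side `T` of `e` in the average `{·}_{β_e}`. On a boundary face it
is `1`; on an interior face with sides `T`, `T'` it is `κ_{T'} / (κ_T + κ_{T'})`, that is,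
`β_e = κ⁻ / (κ⁺ + κ⁻)` on the side `T⁺` and `1 - β_e` on the side `T⁻`. -/
def weight (κ : M.Element → ℝ) (e : M.Face) (T : M.Element) : ℝ :=
  if e.IsBoundary then 1
  else (∑ T' ∈ e.neighbors.erase T, κ T') / ∑ T' ∈ e.neighbors, κ T'

/-- The weighted average `{κ∇v}_{β_e} = β_e κ⁺ (∇v)⁺ + (1 - β_e) κ⁻ (∇v)⁻` on an interior face,
`{κ∇v}_{β_e} = κ∇v` on a boundary face. -/
def fluxAverage (κ : M.Element → ℝ) (v : M.DGSpace) (e : M.Face)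
    (x : EuclideanSpace ℝ (Fin d)) : EuclideanSpace ℝ (Fin d) :=
  ∑ T ∈ e.neighbors, (weight κ e T * κ T) • gradient (v T) x

open Classical in
/-- The face coefficient `κ_e`: the harmonic mean `2κ⁺κ⁻ / (κ⁺ + κ⁻)` on an interior face,
the value `κ_T` of the adjacent element on a boundary face. -/
def faceCoeff (κ : M.Element → ℝ) (e : M.Face) : ℝ :=
  if e.IsBoundary then ∑ T ∈ e.neighbors, κ T
  else 2 * (∏ T ∈ e.neighbors, κ T) / ∑ T ∈ e.neighbors, κ T

/-- `P⁰_e`, the `L²(e)`-projection onto constants, i.e. the mean value over `e`. -/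
def meanProj (e : M.Face) (g : EuclideanSpace ℝ (Fin d) → EuclideanSpace ℝ (Fin d)) :
    EuclideanSpace ℝ (Fin d) :=
  ⨍ x, g x ∂e.measure

/-- `(κ∇v, ∇w)_{T_h}` -/
def diffusionTerm (κ : M.Element → ℝ) (v w : M.DGSpace) : ℝ :=
  ∑ T : M.Element, ∫ x in T.carrier, κ T * ⟪gradient (v T) x, gradient (w T) x⟫

/-- `⟨{κ∇v}_{β_e}, ⟦w⟧⟩_{E_h}` -/
def consistencyTerm (κ : M.Element → ℝ) (v w : M.DGSpace) : ℝ :=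
  ∑ e : M.Face, ∫ x, ⟪fluxAverage κ v e x, jump w e x⟫ ∂e.measure

/-- `⟨α h_e⁻¹ κ_e ⟦v⟧, ⟦w⟧⟩_{E_h}` -/
def penaltyTerm (κ : M.Element → ℝ) (α : ℝ) (v w : M.DGSpace) : ℝ :=
  ∑ e : M.Face, ∫ x, α * (e.size)⁻¹ * faceCoeff κ e * ⟪jump v e x, jump w e x⟫ ∂e.measure

/-- `⟨α h_e⁻¹ κ_e P⁰_e(⟦v⟧), ⟦w⟧⟩_{E_h}` -/
def weakPenaltyTerm (κ : M.Element → ℝ) (α : ℝ) (v w : M.DGSpace) : ℝ :=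
  ∑ e : M.Face, ∫ x,
    α * (e.size)⁻¹ * faceCoeff κ e * ⟪meanProj e (jump v e), jump w e x⟫ ∂e.measure

/-- The IP(β)-1 bilinear form `A`. -/
def ipForm (κ : M.Element → ℝ) (α θ : ℝ) (v w : M.DGSpace) : ℝ :=
  diffusionTerm κ v w - consistencyTerm κ v w + θ * consistencyTerm κ w v
    + penaltyTerm κ α v w

/-- The IP(β)-0 bilinear form `A₀`. -/
def ipFormZero (κ : M.Element → ℝ) (α θ : ℝ) (v w : M.DGSpace) : ℝ :=
  diffusionTerm κ v w - consistencyTerm κ v w + θ * consistencyTerm κ w v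
    + weakPenaltyTerm κ α v w

end SimplicialMesh

end IPDG

end

/-! The two forms differ only in the penalty. On each face the difference is `α κ_e / h_e` times the
squared `L²(e)`-distance of the jump from its mean, which is nonnegative; this gives the first
inequality. For the second, the jump is affine, with slope at most the sum of the gradients of `v`
on the neighbouring elements. Shape regularity gives `h_e |e| ≤ C |T|`, and the harmonic mean
satisfies `κ_e ≤ 2 κ_T`, so the difference of the penalties is at most a multiple of `α` times the
diffusion energy `D` (`penaltyTerm_sub_weakPenaltyTerm_le`).

It remains to prove the coercivity bound `D ≤ 2 A₀(v, v)`. For `θ = 1` the consistency terms cancel.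
Otherwise, the flux of a piecewise affine function is constant on each face, so the consistency term
sees only the mean jump, which is what the weak penalty controls. Young's inequality
(`abs_consistencyTerm_le`) then absorbs it into `D` and the weak penalty once `α` is large. The
bounds are independent of the contrast of `κ` because the weights `β_e` keep each weighted
coefficient below `κ_e` (`weight_mul_le`). -/

namespace IPDG

/-! ### Affine geometry of simplices, and the area of flat sets -/

section Affine

variable {d : ℕ}

/-- The barycentric coordinate of a full-dimensional simplex which vanishes on a facet. -/
theorem exists_barycentric_coord {e T : Finset (EuclideanSpace ℝ (Fin d))}
    (hT : AffineIndependent ℝ ((↑) : T → EuclideanSpace ℝ (Fin d)))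
    (hcard : T.card = d + 1) (he : e.card = d) (hne : e.Nonempty) (heT : e ⊆ T) :
    ∃ a ∈ T, a ∉ e ∧ (∀ x ∈ T, x ∉ e → x = a) ∧ ∃ ℓ : EuclideanSpace ℝ (Fin d) →ᵃ[ℝ] ℝ,
      ℓ a = 1 ∧ (∀ x ∈ e, ℓ x = 0) ∧
      (∀ f : EuclideanSpace ℝ (Fin d) →ᵃ[ℝ] ℝ, (∀ x ∈ e, f x = 0) → ∀ x, f x = f a * ℓ x) ∧
      (∀ b, 0 < ℓ b → ∃ p ∈ convexHull ℝ (T : Set (EuclideanSpace ℝ (Fin d))),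
        p ∈ convexHull ℝ (insert b (e : Set (EuclideanSpace ℝ (Fin d)))) ∧ 0 < ℓ p) := by
  classical
  have hc : (T \ e).card = 1 := by
    rw [Finset.card_sdiff_of_subset heT]; omega
  obtain ⟨a, ha⟩ := Finset.card_eq_one.1 hc
  have haT : a ∈ T ∧ a ∉ e := by
    rw [← Finset.mem_sdiff, ha]; simp
  have huniq : ∀ x ∈ T, x ∉ e → x = a := fun x hx hxe => by
    have : x ∈ T \ e := Finset.mem_sdiff.2 ⟨hx, hxe⟩
    rw [ha] at this
    simpa using this
  have htop : affineSpan ℝ (Set.range ((↑) : T → EuclideanSpace ℝ (Fin d))) = ⊤ := by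
    rw [hT.affineSpan_eq_top_iff_card_eq_finrank_add_one]
    simp [hcard]
  let B : AffineBasis T ℝ (EuclideanSpace ℝ (Fin d)) := ⟨_, hT, htop⟩
  have hB : ∀ i : T, B i = (i : EuclideanSpace ℝ (Fin d)) := fun _ => rfl
  let ℓ := B.coord ⟨a, haT.1⟩
  have hℓa : ℓ a = 1 := B.coord_apply_eq ⟨a, haT.1⟩
  have hℓe : ∀ x ∈ e, ℓ x = 0 := fun x hx =>
    B.coord_apply_ne (i := ⟨a, haT.1⟩) (j := ⟨x, heT hx⟩)
      (fun h => haT.2 (by rw [Subtype.mk.injEq] at h; rw [h]; exact hx))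
  refine ⟨a, haT.1, haT.2, huniq, ℓ, hℓa, hℓe, ?_, ?_⟩
  · intro f hf x
    have : f = f a • ℓ := by
      refine AffineMap.ext_on htop ?_
      rintro _ ⟨⟨y, hy⟩, rfl⟩
      by_cases hye : y ∈ e
      · simp [hf y hye, hℓe y hye]
      · obtain rfl := huniq y hy hye
        simp [hℓa]
    rw [this]; simp [hℓa]
  · intro b hb
    set q := e.centroid ℝ (id : EuclideanSpace ℝ (Fin d) → EuclideanSpace ℝ (Fin d)) with hq
    have hqe : q ∈ convexHull ℝ (e : Set (EuclideanSpace ℝ (Fin d))) :=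
      e.centroid_mem_convexHull hne
    have hcoord : ∀ i : T, (i : EuclideanSpace ℝ (Fin d)) ∈ e → 0 < B.coord i q := by
      intro i hi
      have hq' : q = (Finset.univ.filter fun j : T => (j : EuclideanSpace ℝ (Fin d)) ∈ e).centroid
          ℝ B := by
        have : e = (Finset.univ.filter fun j : T =>
            (j : EuclideanSpace ℝ (Fin d)) ∈ e).map (Function.Embedding.subtype _) := by
          ext x
          simp only [Finset.mem_map, Finset.mem_filter, Finset.mem_univ, true_and]
          constructor
          · intro hx; exact ⟨⟨x, heT hx⟩, hx, rfl⟩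
          · rintro ⟨y, hy, rfl⟩; exact hy
        rw [hq]
        conv_lhs => rw [this]
        rw [Finset.centroid_map]
        rfl
      rw [hq', AffineBasis.coord_apply_centroid _ (by simpa using hi)]
      have : 0 < (Finset.univ.filter fun j : T => (j : EuclideanSpace ℝ (Fin d)) ∈ e).card :=
        Finset.card_pos.2 ⟨i, by simpa using hi⟩
      positivity
    have hℓq : 0 ≤ ℓ q := by
      have : q ∈ {x | 0 ≤ ℓ x} := by
        refine convexHull_min (s := (e : Set (EuclideanSpace ℝ (Fin d)))) ?_ ?_ hqe
        · intro x hx; exact (hℓe x hx).ge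
        · exact (convex_Ici (0 : ℝ)).affine_preimage ℓ
      exact this
    -- Move from the centroid `q` of the facet slightly towards `b`. The coordinates of vertices of
    -- `e` are positive at `q` and stay so by continuity; the remaining one, `ℓ`, stays nonnegative
    -- because `ℓ q ≥ 0` and `ℓ b > 0`. Hence the point stays in the simplex.
    have hev : ∀ i : T, ∀ᶠ t in nhdsWithin (0 : ℝ) (Set.Ioi 0),
        0 ≤ B.coord i (AffineMap.lineMap q b t) := by
      intro i
      by_cases hi : (i : EuclideanSpace ℝ (Fin d)) ∈ e
      · have hcont : Continuous fun t : ℝ => B.coord i (AffineMap.lineMap q b t) := by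
          have h1 := AffineMap.continuous_of_finiteDimensional (B.coord i)
          exact h1.comp AffineMap.lineMap_continuous
        have : ∀ᶠ t in nhds (0 : ℝ), 0 < B.coord i (AffineMap.lineMap q b t) := by
          refine hcont.continuousAt.eventually (lt_mem_nhds ?_)
          simpa using hcoord i hi
        exact (this.filter_mono nhdsWithin_le_nhds).mono fun t ht => ht.le
      · obtain rfl : i = ⟨a, haT.1⟩ := Subtype.ext (huniq i i.2 hi)
        have h1 : ∀ᶠ t in nhds (0 : ℝ), t < 1 := gt_mem_nhds one_pos
        filter_upwards [self_mem_nhdsWithin, h1.filter_mono nhdsWithin_le_nhds] with t ht ht1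
        change 0 ≤ ℓ (AffineMap.lineMap q b t)
        rw [AffineMap.apply_lineMap, AffineMap.lineMap_apply_module]
        have ht0 : 0 < t := ht
        have := mul_nonneg (sub_nonneg.2 ht1.le) hℓq
        simp only [smul_eq_mul]
        positivity
    have h1 : ∀ᶠ t in nhds (0 : ℝ), t < 1 := gt_mem_nhds one_pos
    have h0 : ∀ᶠ t in nhdsWithin (0 : ℝ) (Set.Ioi 0), 0 < t := self_mem_nhdsWithin
    obtain ⟨t, ht, ht0, ht1⟩ := ((Filter.eventually_all.2 hev).and
      (h0.and (h1.filter_mono nhdsWithin_le_nhds))).exists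
    refine ⟨AffineMap.lineMap q b t, ?_, ?_, ?_⟩
    · have := B.convexHull_eq_nonneg_coord
      rw [show (Set.range B) = (T : Set (EuclideanSpace ℝ (Fin d))) from Subtype.range_coe] at this
      rw [this]
      exact ht
    · refine (convex_convexHull ℝ _).lineMap_mem ?_ ?_ ⟨ht0.le, ht1.le⟩
      · exact convexHull_mono (Set.subset_insert _ _) hqe
      · exact subset_convexHull ℝ _ (Set.mem_insert _ _)
    · rw [AffineMap.apply_lineMap, AffineMap.lineMap_apply_module]
      have := mul_nonneg (sub_nonneg.2 ht1.le) hℓq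
      simp only [smul_eq_mul]
      positivity

/-- The gradient of an affine function is constant, and its norm is a Lipschitz constant. -/
theorem gradient_const_and_abs_sub_le (f : EuclideanSpace ℝ (Fin d) →ᵃ[ℝ] ℝ) :
    (∀ x, gradient f x = gradient f 0) ∧
      ∀ x y, |f x - f y| ≤ ‖gradient f 0‖ * dist x y := by
  set g := (InnerProductSpace.toDual ℝ (EuclideanSpace ℝ (Fin d))).symm
    (LinearMap.toContinuousLinearMap f.linear) with hg
  have hgrad : ∀ x, gradient f x = g := by
    intro x
    refine HasGradientAt.gradient ?_
    rw [hasGradientAt_iff_hasFDerivAt, hg, LinearIsometryEquiv.apply_symm_apply]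
    have h : (f : EuclideanSpace ℝ (Fin d) → ℝ) =
        fun x => LinearMap.toContinuousLinearMap f.linear x + f 0 := by
      ext x
      have := f.decomp
      rw [this]; simp
    rw [h]
    exact (ContinuousLinearMap.hasFDerivAt _).add_const _
  refine ⟨fun x => by rw [hgrad, hgrad], fun x y => ?_⟩
  have : f x - f y = ⟪g, x - y⟫ := by
    rw [hg, InnerProductSpace.toDual_symm_apply]
    simp [← vsub_eq_sub]
  rw [this, hgrad, dist_eq_norm]
  exact abs_real_inner_le_norm _ _

/-- The `k`-dimensional area of a bounded set with `k`-dimensional affine span. -/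
theorem euclideanHausdorffMeasure_le_volume_closedBall {k : ℕ}
    {s : Set (EuclideanSpace ℝ (Fin d))} (hs : Bornology.IsBounded s)
    (hk : Module.finrank ℝ (vectorSpan ℝ s) = k) :
    μHE[k] s ≤ volume (Metric.closedBall (0 : EuclideanSpace ℝ (Fin k)) (Metric.diam s)) := by
  rcases s.eq_empty_or_nonempty with rfl | ⟨p, hp⟩
  · simp
  -- Orthonormal coordinates on the span, based at a point `p` of `s`, embed `ℝ^k` isometrically,
  -- and `s` lies in the image of the ball of radius `diam s`.
  let b := (stdOrthonormalBasis ℝ (vectorSpan ℝ s)).reindex (finCongr hk)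
  let f : EuclideanSpace ℝ (Fin k) → EuclideanSpace ℝ (Fin d) :=
    fun y => (b.repr.symm y : EuclideanSpace ℝ (Fin d)) + p
  have hf : Isometry f := by
    refine Isometry.of_dist_eq fun x y => ?_
    simp only [f, dist_add_right]
    rw [← Subtype.dist_eq]
    exact b.repr.symm.dist_map x y
  rw [← EuclideanSpace.euclideanHausdorffMeasure_eq_volume,
    ← hf.euclideanHausdorffMeasure_image (d := k)]
  refine measure_mono fun x hx => ?_
  have hxp : x - p ∈ vectorSpan ℝ s := vsub_mem_vectorSpan ℝ hx hp
  refine ⟨b.repr ⟨x - p, hxp⟩, ?_, ?_⟩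
  · rw [mem_closedBall_zero_iff, LinearIsometryEquiv.norm_map]
    change ‖x - p‖ ≤ _
    rw [← dist_eq_norm]
    exact Metric.dist_le_diam_of_mem hs hx hp
  · simp [f]

end Affine

/-! ### Adjacency and scaling in a shape regular mesh -/

namespace SimplicialMesh

variable {d : ℕ} {Ω : Set (EuclideanSpace ℝ (Fin d))} {M : SimplicialMesh d Ω}

theorem Face.mem_neighbors {e : M.Face} {T : M.Element} : T ∈ e.neighbors ↔ e.1 ⊆ T.1 := by
  simp [Face.neighbors]

theorem Face.nonempty (e : M.Face) : e.1.Nonempty := M.nonempty_of_mem_faces e.2.1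

theorem Face.one_le_card_neighbors (e : M.Face) : 1 ≤ e.neighbors.card := by
  obtain ⟨T, hT, heT, hc⟩ := M.exists_element e.1 e.2.1
  exact Finset.card_pos.2 ⟨⟨T, hT, hc⟩, Face.mem_neighbors.2 heT⟩

/-- A face of a conforming mesh belongs to at most two elements. -/
theorem Face.card_neighbors_le_two (e : M.Face) : e.neighbors.card ≤ 2 := by
  classical
  by_contra! h
  obtain ⟨T₁, h₁, T₂, h₂, T₃, h₃, h₁₂, h₁₃, h₂₃⟩ := Finset.two_lt_card.1 h
  rw [Face.mem_neighbors] at h₁ h₂ h₃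
  obtain ⟨a₁, ha₁, hae₁, hu₁, ℓ₁, h1₁, h0₁, hf₁, hp₁⟩ :=
    exists_barycentric_coord (M.indep T₁.2.1) T₁.2.2 e.2.2 e.nonempty h₁
  obtain ⟨a₂, ha₂, hae₂, hu₂, ℓ₂, h1₂, h0₂, hf₂, hp₂⟩ :=
    exists_barycentric_coord (M.indep T₂.2.1) T₂.2.2 e.2.2 e.nonempty h₂
  obtain ⟨a₃, ha₃, hae₃, hu₃, ℓ₃, h1₃, h0₃, hf₃, hp₃⟩ :=
    exists_barycentric_coord (M.indep T₃.2.1) T₃.2.2 e.2.2 e.nonempty h₃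
  -- Distinct elements sharing `e` lie on opposite sides of it: otherwise they would share a point
  -- with `ℓ > 0` near `e`, whereas conformity puts their intersection in the hull of their common
  -- vertices, all of which lie in `e`.
  have key : ∀ (T T' : M.Element) (a a' : EuclideanSpace ℝ (Fin d))
      (ℓ : EuclideanSpace ℝ (Fin d) →ᵃ[ℝ] ℝ), T ≠ T' → e.1 ⊆ T.1 → e.1 ⊆ T'.1 →
      (∀ x ∈ T.1, x ∉ e.1 → x = a) → a' ∈ T'.1 → (∀ x ∈ T'.1, x ∉ e.1 → x = a') →
      (∀ x ∈ e.1, ℓ x = 0) →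
      (∀ b, 0 < ℓ b → ∃ p ∈ convexHull ℝ (T.1 : Set (EuclideanSpace ℝ (Fin d))),
        p ∈ convexHull ℝ (insert b (e.1 : Set (EuclideanSpace ℝ (Fin d)))) ∧ 0 < ℓ p) →
      ℓ a' ≤ 0 := by
    intro T T' a a' ℓ hne hT hT' hu ha' hu' h0 hp
    by_contra! hpos
    obtain ⟨p, hpT, hpb, hp0⟩ := hp a' hpos
    have hpT' : p ∈ convexHull ℝ (T'.1 : Set (EuclideanSpace ℝ (Fin d))) :=
      convexHull_mono (Set.insert_subset ha' hT') hpb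
    have hpi := M.inter_subset_convexHull T.2.1 T'.2.1 ⟨hpT, hpT'⟩
    have hsub : (T.1 : Set (EuclideanSpace ℝ (Fin d))) ∩ T'.1 ⊆ {x | ℓ x ≤ 0} := by
      rintro x ⟨hx, hx'⟩
      by_cases hxe : x ∈ e.1
      · exact (h0 x hxe).le
      · exfalso
        have h1 := hu x hx hxe
        have h2 := hu' x hx' hxe
        refine hne (Subtype.ext (Finset.Subset.antisymm ?_ ?_))
        · intro y hy
          by_cases hye : y ∈ e.1
          · exact hT' hye
          · rw [hu y hy hye, ← h1, h2]; exact ha'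
        · intro y hy
          by_cases hye : y ∈ e.1
          · exact hT hye
          · rw [hu' y hy hye, ← h2]; exact hx
    have := convexHull_min hsub ((convex_Iic (0 : ℝ)).affine_preimage ℓ) hpi
    exact absurd hp0 (not_lt.2 this)
  have k₁₂ : ℓ₁ a₂ ≤ 0 := key T₁ T₂ a₁ a₂ ℓ₁ h₁₂ h₁ h₂ hu₁ ha₂ hu₂ h0₁ hp₁
  have k₁₃ : ℓ₁ a₃ ≤ 0 := key T₁ T₃ a₁ a₃ ℓ₁ h₁₃ h₁ h₃ hu₁ ha₃ hu₃ h0₁ hp₁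
  have k₂₃ : ℓ₂ a₃ ≤ 0 := key T₂ T₃ a₂ a₃ ℓ₂ h₂₃ h₂ h₃ hu₂ ha₃ hu₃ h0₂ hp₂
  -- Functions vanishing on `e` are proportional. The product of two nonpositive numbers makes `ℓ₁
  -- a₃ ≥ 0`, so it vanishes, and then so does `ℓ₁ a₁ = 1`: three points cannot be pairwise
  -- separated by one hyperplane.
  have e₁ : ℓ₁ a₃ = ℓ₁ a₂ * ℓ₂ a₃ := hf₂ ℓ₁ h0₁ a₃
  have e₂ : ℓ₁ a₁ = ℓ₁ a₃ * ℓ₃ a₁ := hf₃ ℓ₁ h0₁ a₁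
  have : ℓ₁ a₃ = 0 := by nlinarith
  rw [h1₁, this, zero_mul] at e₂
  exact one_ne_zero e₂

theorem Face.isBounded_carrier (e : M.Face) : Bornology.IsBounded e.carrier :=
  isBounded_convexHull.2 e.1.finite_toSet.isBounded

theorem Face.isCompact_carrier (e : M.Face) : IsCompact e.carrier :=
  e.1.finite_toSet.isCompact_convexHull (𝕜 := ℝ)

theorem Element.isCompact_carrier (T : M.Element) : IsCompact T.carrier :=
  T.1.finite_toSet.isCompact_convexHull (𝕜 := ℝ)

theorem Face.size_nonneg (e : M.Face) : 0 ≤ e.size := Metric.diam_nonneg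

theorem Face.size_pos (e : M.Face) (hd : 2 ≤ d) : 0 < e.size := by
  obtain ⟨x, hx, y, hy, hxy⟩ := Finset.one_lt_card.1 (by rw [e.2.2]; omega : 1 < e.1.card)
  exact (dist_pos.2 hxy).trans_le (Metric.dist_le_diam_of_mem e.isBounded_carrier
    (subset_convexHull ℝ _ hx) (subset_convexHull ℝ _ hy))

theorem Face.measure_univ_le (e : M.Face) (hd : 1 ≤ d) :
    e.measure Set.univ ≤
      volume (Metric.closedBall (0 : EuclideanSpace ℝ (Fin (d - 1))) e.size) := by
  rw [Face.measure, Measure.restrict_apply_univ]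
  refine euclideanHausdorffMeasure_le_volume_closedBall e.isBounded_carrier ?_
  rw [← direction_affineSpan, Face.carrier, affineSpan_convexHull, direction_affineSpan]
  have := (M.indep e.2.1).finrank_vectorSpan (n := d - 1)
    (by rw [Fintype.card_coe, e.2.2]; omega)
  rwa [Subtype.range_coe_subtype] at this

theorem Face.isFiniteMeasure (e : M.Face) (hd : 1 ≤ d) : IsFiniteMeasure e.measure :=
  ⟨(e.measure_univ_le hd).trans_lt measure_closedBall_lt_top⟩

/-- The `k`-dimensional volume of the unit ball. -/
noncomputable def ballVolume (k : ℕ) : ℝ :=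
  volume.real (Metric.ball (0 : EuclideanSpace ℝ (Fin k)) 1)

theorem ballVolume_pos (k : ℕ) : 0 < ballVolume k :=
  ENNReal.toReal_pos (Metric.measure_ball_pos _ _ one_pos).ne' measure_ball_lt_top.ne

theorem volume_real_closedBall (k : ℕ) (x : EuclideanSpace ℝ (Fin k)) {r : ℝ} (hr : 0 ≤ r) :
    volume.real (Metric.closedBall x r) = r ^ k * ballVolume k := by
  rw [measureReal_def, Measure.addHaar_closedBall _ _ hr, ENNReal.toReal_mul,
    ENNReal.toReal_ofReal (by positivity), finrank_euclideanSpace_fin]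
  rfl

/-- On a shape regular mesh `h_e |e| ≤ meshConstant d σ * |T|` for every face `e` of `T`. -/
noncomputable def meshConstant (d : ℕ) (σ : ℝ) : ℝ :=
  |σ| ^ d * (ballVolume (d - 1) / ballVolume d)

theorem meshConstant_nonneg (d : ℕ) (σ : ℝ) : 0 ≤ meshConstant d σ := by
  have := ballVolume_pos d
  have := ballVolume_pos (d - 1)
  unfold meshConstant; positivity

/-- The area of `e` is at most that of a `(d-1)`-ball of radius `h_e`, while `T` contains a `d`-ball
of radius `r` with `h_e ≤ diam T ≤ |σ| r`. -/
theorem Face.size_mul_measure_le (hd : 1 ≤ d) {σ : ℝ} (hσ : M.IsShapeRegular σ) {e : M.Face}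
    {T : M.Element} (hT : T ∈ e.neighbors) :
    e.size * e.measure.real Set.univ ≤ meshConstant d σ * volume.real T.carrier := by
  obtain ⟨x, r, hr, hball, hdiam⟩ := hσ T
  have h1 : e.measure.real Set.univ ≤ e.size ^ (d - 1) * ballVolume (d - 1) := by
    rw [← volume_real_closedBall _ 0 e.size_nonneg]
    exact ENNReal.toReal_mono measure_closedBall_lt_top.ne (e.measure_univ_le hd)
  have h2 : r ^ d * ballVolume d ≤ volume.real T.carrier := by
    rw [← volume_real_closedBall _ x hr.le]
    exact measureReal_mono hball T.isCompact_carrier.measure_lt_top.ne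
  have h3 : e.size ≤ |σ| * r := by
    refine (Metric.diam_mono (convexHull_mono (Face.mem_neighbors.1 hT))
      T.isCompact_carrier.isBounded).trans (hdiam.trans ?_)
    gcongr
    exact le_abs_self σ
  have hb := ballVolume_pos d
  have hb' := ballVolume_pos (d - 1)
  have hs := e.size_nonneg
  calc e.size * e.measure.real Set.univ
      ≤ e.size * (e.size ^ (d - 1) * ballVolume (d - 1)) := by gcongr
    _ = e.size ^ d * ballVolume (d - 1) := by
        rw [← mul_assoc, mul_comm e.size, ← pow_succ, Nat.sub_add_cancel hd]
    _ ≤ (|σ| * r) ^ d * ballVolume (d - 1) := by gcongr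
    _ = meshConstant d σ * (r ^ d * ballVolume d) := by
        rw [mul_pow, meshConstant]; field_simp
    _ ≤ meshConstant d σ * volume.real T.carrier := by
        gcongr
        exact meshConstant_nonneg d σ

/-- Each element has at most `2 ^ (d + 1)` faces. -/
theorem sum_faces_sum_neighbors_le (X : M.Element → ℝ) (hX : ∀ T, 0 ≤ X T) :
    ∑ e : M.Face, ∑ T ∈ e.neighbors, X T ≤ 2 ^ (d + 1) * ∑ T, X T := by
  classical
  have : ∑ e : M.Face, ∑ T ∈ e.neighbors, X T =
      ∑ T : M.Element, ∑ e : M.Face with e.1 ⊆ T.1, X T := by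
    refine Finset.sum_comm' fun e T => ?_
    simp [Face.mem_neighbors]
  rw [this, Finset.mul_sum]
  refine Finset.sum_le_sum fun T _ => ?_
  rw [Finset.sum_const, nsmul_eq_mul]
  refine mul_le_mul_of_nonneg_right ?_ (hX T)
  have : (Finset.univ.filter fun e : M.Face => e.1 ⊆ T.1).card ≤ T.1.powerset.card := by
    refine Finset.card_le_card_of_injOn (fun e => e.1) ?_ Subtype.val_injective.injOn
    intro e he
    simpa using he
  rw [Finset.card_powerset, T.2.2] at this
  exact_mod_cast this

theorem Face.exists_neighbors_eq (e : M.Face) :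
    (e.IsBoundary ∧ ∃ T, e.neighbors = {T}) ∨
      (¬ e.IsBoundary ∧ ∃ T T', T ≠ T' ∧ e.neighbors = {T, T'}) := by
  classical
  have h1 := e.one_le_card_neighbors
  have h2 := e.card_neighbors_le_two
  by_cases h : e.IsBoundary
  · exact Or.inl ⟨h, Finset.card_eq_one.1 h⟩
  · refine Or.inr ⟨h, ?_⟩
    have : e.neighbors.card ≠ 1 := h
    obtain ⟨T, T', hne, heq⟩ := Finset.card_eq_two.1 (by omega : e.neighbors.card = 2)
    exact ⟨T, T', hne, by rw [heq]⟩

/-! ### Coefficient bounds independent of the contrast -/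

theorem faceCoeff_nonneg {κ : M.Element → ℝ} (hκ : ∀ T, 0 < κ T) (e : M.Face) : 0 ≤ faceCoeff κ e := by
  unfold faceCoeff
  have h1 := Finset.sum_nonneg fun T (_ : T ∈ e.neighbors) => (hκ T).le
  have h2 := Finset.prod_nonneg fun T (_ : T ∈ e.neighbors) => (hκ T).le
  split_ifs
  · exact h1
  · positivity

/-- The harmonic mean is at most twice the smaller coefficient, so face terms can be charged to
either neighbour, however small its `κ`. -/
theorem faceCoeff_le {κ : M.Element → ℝ} (hκ : ∀ T, 0 < κ T) {e : M.Face} {T : M.Element} (hT : T ∈ e.neighbors) :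
    faceCoeff κ e ≤ 2 * κ T := by
  classical
  obtain ⟨hb, S, hS⟩ | ⟨hb, S, S', hne, hS⟩ := e.exists_neighbors_eq
  · rw [hS, Finset.mem_singleton] at hT
    subst hT
    rw [faceCoeff, if_pos hb, hS, Finset.sum_singleton]
    linarith [hκ T]
  · have h := hκ S
    have h' := hκ S'
    rw [faceCoeff, if_neg hb, hS, Finset.sum_pair hne, Finset.prod_pair hne]
    rw [hS, Finset.mem_insert, Finset.mem_singleton] at hT
    rw [div_le_iff₀ (by positivity)]
    rcases hT with rfl | rfl <;> nlinarith [mul_pos h h']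

theorem weight_mul_nonneg {κ : M.Element → ℝ} (hκ : ∀ T, 0 < κ T) (e : M.Face) (T : M.Element) : 0 ≤ weight κ e T * κ T := by
  classical
  refine mul_nonneg ?_ (hκ T).le
  unfold weight
  split_ifs
  · exact zero_le_one
  · exact div_nonneg (Finset.sum_nonneg fun T _ => (hκ T).le)
      (Finset.sum_nonneg fun T _ => (hκ T).le)

/-- On an interior face both sides carry the same weighted coefficient `κ⁺κ⁻ / (κ⁺ + κ⁻) = κ_e / 2`;
on a boundary face it equals `κ_e`. -/
theorem weight_mul_le {κ : M.Element → ℝ} (hκ : ∀ T, 0 < κ T) {e : M.Face} {T : M.Element} (hT : T ∈ e.neighbors) :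
    weight κ e T * κ T ≤ faceCoeff κ e := by
  classical
  obtain ⟨hb, S, hS⟩ | ⟨hb, S, S', hne, hS⟩ := e.exists_neighbors_eq
  · rw [hS, Finset.mem_singleton] at hT
    subst hT
    rw [faceCoeff, weight, if_pos hb, if_pos hb, hS, Finset.sum_singleton, one_mul]
  · have h := hκ S
    have h' := hκ S'
    rw [faceCoeff, weight, if_neg hb, if_neg hb, hS, Finset.sum_pair hne, Finset.prod_pair hne]
    rw [hS, Finset.mem_insert, Finset.mem_singleton] at hT
    rw [div_mul_eq_mul_div]
    refine div_le_div_of_nonneg_right ?_ (by positivity)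
    rcases hT with rfl | rfl
    · rw [Finset.erase_insert (by simpa using hne), Finset.sum_singleton]
      nlinarith [mul_pos h h']
    · rw [Finset.pair_comm, Finset.erase_insert (by simpa using hne.symm), Finset.sum_singleton]
      nlinarith [mul_pos h h']

end SimplicialMesh

/-! ### The mean and variance of a vector-valued function -/

section Variance

variable {α E : Type*} [MeasurableSpace α] {μ : Measure α} [IsFiniteMeasure μ]
  [NormedAddCommGroup E] [InnerProductSpace ℝ E] [CompleteSpace E] {f : α → E}

theorem integral_inner_average (hf : Integrable f μ) :
    ∫ x, ⟪⨍ y, f y ∂μ, f x⟫ ∂μ = μ.real Set.univ * ‖⨍ y, f y ∂μ‖ ^ 2 := by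
  rw [integral_inner hf, ← measure_smul_average, real_inner_smul_right,
    real_inner_self_eq_norm_sq]

/-- The parallel axis identity. With `c` the mean it shows that the variance is nonnegative; with
`c` a value of `f` it bounds the variance by the oscillation. -/
theorem integral_norm_sub_sq (hf : Integrable f μ) (hf2 : Integrable (fun x => ‖f x‖ ^ 2) μ)
    (c : E) :
    ∫ x, ‖f x - c‖ ^ 2 ∂μ =
      ∫ x, ‖f x‖ ^ 2 ∂μ - μ.real Set.univ * ‖⨍ y, f y ∂μ‖ ^ 2
        + μ.real Set.univ * ‖(⨍ y, f y ∂μ) - c‖ ^ 2 := by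
  have h1 : ∀ x, ‖f x - c‖ ^ 2 = ‖f x‖ ^ 2 - 2 * ⟪c, f x⟫ + ‖c‖ ^ 2 := fun x => by
    rw [norm_sub_sq_real, real_inner_comm]
  simp_rw [h1]
  have hc : Integrable (fun x => 2 * ⟪c, f x⟫) μ := (hf.const_inner c).const_mul 2
  have h2 : Integrable (fun x => ‖f x‖ ^ 2 - 2 * ⟪c, f x⟫) μ := hf2.sub hc
  rw [integral_add h2 (integrable_const _), integral_sub hf2 hc, integral_const_mul,
    integral_inner hf, ← measure_smul_average μ f, real_inner_smul_right, integral_const,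
    norm_sub_sq_real, real_inner_comm, smul_eq_mul]
  ring

end Variance

/-! ### Jumps and fluxes on a face -/

namespace SimplicialMesh

variable {d : ℕ} {Ω : Set (EuclideanSpace ℝ (Fin d))} {M : SimplicialMesh d Ω}

/-- The upper bound is all that the estimates need; it covers the default value `0` of the
normalization of `0`, so the projection need not be shown nonzero. -/
theorem norm_outwardNormal_le_one (T : M.Element) (e : M.Face) : ‖outwardNormal T e‖ ≤ 1 := by
  unfold outwardNormal
  set w := (vectorSpan ℝ (e.1 : Set (EuclideanSpace ℝ (Fin d))))ᗮ.starProjection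
      (e.1.centroid ℝ id - T.1.centroid ℝ id)
  by_cases h : w = 0
  · simp [h]
  · exact (NormedSpace.norm_normalize_eq_one_iff.2 h).le

theorem continuous_jump (v : M.DGSpace) (e : M.Face) : Continuous (jump v e) := by
  unfold jump
  refine continuous_finsetSum _ fun T _ => ?_
  have := AffineMap.continuous_of_finiteDimensional (v T)
  fun_prop

theorem Face.integrable {F : Type*} [NormedAddCommGroup F] (e : M.Face) (hd : 1 ≤ d)
    {f : EuclideanSpace ℝ (Fin d) → F} (hf : Continuous f) : Integrable f e.measure := by
  have := e.isFiniteMeasure hd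
  obtain ⟨C, hC⟩ := e.isCompact_carrier.exists_bound_of_continuousOn hf.continuousOn
  refine Integrable.of_bound hf.aestronglyMeasurable C ?_
  exact ae_restrict_of_forall_mem e.isCompact_carrier.measurableSet hC

theorem norm_jump_sub_le (v : M.DGSpace) (e : M.Face) (x y : EuclideanSpace ℝ (Fin d)) :
    ‖jump v e x - jump v e y‖ ≤ (∑ T ∈ e.neighbors, ‖gradient (v T) 0‖) * dist x y := by
  unfold jump
  rw [← Finset.sum_sub_distrib, Finset.sum_mul]
  refine norm_sum_le_of_le _ fun T _ => ?_
  rw [← sub_smul, norm_smul, Real.norm_eq_abs]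
  exact (mul_le_of_le_one_right (abs_nonneg _) (norm_outwardNormal_le_one T e)).trans
    ((gradient_const_and_abs_sub_le (v T)).2 x y)

/-- The squared `L²(e)`-norm of `P⁰_e ⟦v⟧`. -/
noncomputable def meanJumpSq (v : M.DGSpace) (e : M.Face) : ℝ :=
  e.measure.real Set.univ * ‖meanProj e (jump v e)‖ ^ 2

theorem meanJumpSq_nonneg (v : M.DGSpace) (e : M.Face) : 0 ≤ meanJumpSq v e := by
  unfold meanJumpSq; positivity

theorem integral_meanProj_inner_jump (hd : 1 ≤ d) (v : M.DGSpace) (e : M.Face) :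
    ∫ x, ⟪meanProj e (jump v e), jump v e x⟫ ∂e.measure = meanJumpSq v e := by
  have := e.isFiniteMeasure hd
  exact integral_inner_average (e.integrable hd (continuous_jump v e))

theorem meanJumpSq_le (hd : 1 ≤ d) (v : M.DGSpace) (e : M.Face) :
    meanJumpSq v e ≤ ∫ x, ‖jump v e x‖ ^ 2 ∂e.measure := by
  have := e.isFiniteMeasure hd
  have hJ := continuous_jump v e
  have h := integral_norm_sub_sq (e.integrable hd hJ) (e.integrable hd (hJ.norm.pow 2))
    (meanProj e (jump v e))
  have h0 : 0 ≤ ∫ x, ‖jump v e x - meanProj e (jump v e)‖ ^ 2 ∂e.measure :=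
    integral_nonneg fun x => by positivity
  rw [h] at h0
  simpa [meanProj, meanJumpSq] using h0

/-- A Poincaré inequality on the face: the variance is at most the mean square deviation from the
value at a vertex, and the jump is Lipschitz. The factor `2` is Cauchy–Schwarz over at most two
neighbours. -/
theorem integral_jump_sq_sub_le (hd : 1 ≤ d) (v : M.DGSpace) (e : M.Face) :
    ∫ x, ‖jump v e x‖ ^ 2 ∂e.measure - meanJumpSq v e ≤
      2 * e.size ^ 2 * e.measure.real Set.univ * ∑ T ∈ e.neighbors, ‖gradient (v T) 0‖ ^ 2 := by
  have := e.isFiniteMeasure hd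
  have hJ := continuous_jump v e
  obtain ⟨p, hp⟩ := e.nonempty
  have hp : p ∈ e.carrier := subset_convexHull ℝ _ hp
  have h := integral_norm_sub_sq (e.integrable hd hJ) (e.integrable hd (hJ.norm.pow 2))
    (jump v e p)
  set G := ∑ T ∈ e.neighbors, ‖gradient (v T) 0‖ with hG
  have hG0 : 0 ≤ G := Finset.sum_nonneg fun _ _ => norm_nonneg _
  have h1 : ∫ x, ‖jump v e x - jump v e p‖ ^ 2 ∂e.measure ≤
      ∫ _, (G * e.size) ^ 2 ∂e.measure := by
    refine integral_mono_ae (e.integrable hd (by fun_prop)) (integrable_const _) ?_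
    refine ae_restrict_of_forall_mem e.isCompact_carrier.measurableSet fun x hx => ?_
    have := norm_jump_sub_le v e x p
    have h2 : dist x p ≤ e.size := Metric.dist_le_diam_of_mem e.isBounded_carrier hx hp
    have h3 : ‖jump v e x - jump v e p‖ ≤ G * e.size := this.trans (by gcongr)
    change ‖jump v e x - jump v e p‖ ^ 2 ≤ (G * e.size) ^ 2
    gcongr
  have h2 : G ^ 2 ≤ 2 * ∑ T ∈ e.neighbors, ‖gradient (v T) 0‖ ^ 2 := by
    refine sq_sum_le_card_mul_sum_sq.trans ?_
    gcongr
    exact_mod_cast e.card_neighbors_le_two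
  have h3 : 0 ≤ e.measure.real Set.univ * ‖meanProj e (jump v e) - jump v e p‖ ^ 2 := by
    positivity
  rw [integral_const, smul_eq_mul, h] at h1
  have h4 : e.measure.real Set.univ * (G * e.size) ^ 2 ≤ e.measure.real Set.univ *
      ((2 * ∑ T ∈ e.neighbors, ‖gradient (v T) 0‖ ^ 2) * e.size ^ 2) := by
    rw [mul_pow]; gcongr
  simp only [meanProj, meanJumpSq] at h3 ⊢
  linarith

theorem fluxAverage_const (κ : M.Element → ℝ) (v : M.DGSpace) (e : M.Face)
    (x : EuclideanSpace ℝ (Fin d)) : fluxAverage κ v e x = fluxAverage κ v e 0 := by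
  unfold fluxAverage
  exact Finset.sum_congr rfl fun T _ => by rw [(gradient_const_and_abs_sub_le (v T)).1 x]

theorem norm_fluxAverage_le {κ : M.Element → ℝ} (hκ : ∀ T, 0 < κ T) (v : M.DGSpace)
    (e : M.Face) :
    ‖fluxAverage κ v e 0‖ ≤ ∑ T ∈ e.neighbors, faceCoeff κ e * ‖gradient (v T) 0‖ := by
  unfold fluxAverage
  refine norm_sum_le_of_le _ fun T hT => ?_
  rw [norm_smul, Real.norm_eq_abs, abs_of_nonneg (weight_mul_nonneg hκ e T)]
  exact mul_le_mul_of_nonneg_right (weight_mul_le hκ hT) (norm_nonneg _)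

/-- Since the flux is constant, only the mean jump enters; hence the weak penalty suffices for
coercivity. -/
theorem integral_fluxAverage_inner_jump (hd : 1 ≤ d) (κ : M.Element → ℝ) (v : M.DGSpace)
    (e : M.Face) :
    ∫ x, ⟪fluxAverage κ v e x, jump v e x⟫ ∂e.measure =
      e.measure.real Set.univ * ⟪fluxAverage κ v e 0, meanProj e (jump v e)⟫ := by
  have := e.isFiniteMeasure hd
  simp_rw [fluxAverage_const κ v e]
  rw [integral_inner (e.integrable hd (continuous_jump v e)), ← measure_smul_average,
    real_inner_smul_right]
  rfl

/-- The contribution of the element `T` to the diffusion term. -/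
noncomputable def elementEnergy (κ : M.Element → ℝ) (v : M.DGSpace) (T : M.Element) : ℝ :=
  κ T * (volume.real T.carrier * ‖gradient (v T) 0‖ ^ 2)

theorem elementEnergy_nonneg {κ : M.Element → ℝ} (hκ : ∀ T, 0 < κ T) (v : M.DGSpace)
    (T : M.Element) : 0 ≤ elementEnergy κ v T :=
  mul_nonneg (hκ T).le (by positivity)

theorem diffusionTerm_self (κ : M.Element → ℝ) (v : M.DGSpace) :
    diffusionTerm κ v v = ∑ T, elementEnergy κ v T := by
  unfold diffusionTerm elementEnergy
  refine Finset.sum_congr rfl fun T _ => ?_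
  simp_rw [(gradient_const_and_abs_sub_le (v T)).1, real_inner_self_eq_norm_sq]
  rw [setIntegral_const, smul_eq_mul]
  ring

/-! ### Bounds for the penalty gap and the consistency term -/

/-- The discrete trace inequality: for constant gradients it reduces to comparing `h_e |e|` with
`|T|` and `κ_e` with `κ_T`. -/
theorem faceCoeff_mul_sum_le (hd : 1 ≤ d) {σ : ℝ} (hσ : M.IsShapeRegular σ)
    {κ : M.Element → ℝ} (hκ : ∀ T, 0 < κ T) (v : M.DGSpace) (e : M.Face) :
    faceCoeff κ e * (e.size * e.measure.real Set.univ) *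
        ∑ T ∈ e.neighbors, ‖gradient (v T) 0‖ ^ 2 ≤
      2 * meshConstant d σ * ∑ T ∈ e.neighbors, elementEnergy κ v T := by
  rw [Finset.mul_sum, Finset.mul_sum]
  refine Finset.sum_le_sum fun T hT => ?_
  have h1 := faceCoeff_le hκ hT
  have h2 := Face.size_mul_measure_le hd hσ hT
  have h3 := hκ T
  have h4 := e.size_nonneg
  calc faceCoeff κ e * (e.size * e.measure.real Set.univ) * ‖gradient (v T) 0‖ ^ 2
      ≤ (2 * κ T) * (meshConstant d σ * volume.real T.carrier) * ‖gradient (v T) 0‖ ^ 2 := by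
        gcongr
    _ = _ := by unfold elementEnergy; ring

/-- `∑ₑ κₑ hₑ⁻¹ ‖P⁰_e ⟦v⟧‖²_e` -/
noncomputable def meanJumpSeminormSq (κ : M.Element → ℝ) (v : M.DGSpace) : ℝ :=
  ∑ e : M.Face, faceCoeff κ e * e.size⁻¹ * meanJumpSq v e

theorem meanJumpSeminormSq_nonneg {κ : M.Element → ℝ} (hκ : ∀ T, 0 < κ T) (v : M.DGSpace) :
    0 ≤ meanJumpSeminormSq κ v :=
  Finset.sum_nonneg fun e _ => mul_nonneg
    (mul_nonneg (faceCoeff_nonneg hκ e) (inv_nonneg.2 e.size_nonneg)) (meanJumpSq_nonneg v e)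

theorem weakPenaltyTerm_self (hd : 1 ≤ d) (κ : M.Element → ℝ) (α : ℝ) (v : M.DGSpace) :
    weakPenaltyTerm κ α v v = α * meanJumpSeminormSq κ v := by
  unfold weakPenaltyTerm meanJumpSeminormSq
  rw [Finset.mul_sum]
  refine Finset.sum_congr rfl fun e _ => ?_
  rw [integral_const_mul, integral_meanProj_inner_jump hd]
  ring

theorem penaltyTerm_self (κ : M.Element → ℝ) (α : ℝ) (v : M.DGSpace) :
    penaltyTerm κ α v v =
      ∑ e : M.Face, α * e.size⁻¹ * faceCoeff κ e * ∫ x, ‖jump v e x‖ ^ 2 ∂e.measure := by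
  unfold penaltyTerm
  simp_rw [integral_const_mul, real_inner_self_eq_norm_sq]

theorem weakPenaltyTerm_le_penaltyTerm (hd : 1 ≤ d) {κ : M.Element → ℝ} (hκ : ∀ T, 0 < κ T)
    {α : ℝ} (hα : 0 ≤ α) (v : M.DGSpace) :
    weakPenaltyTerm κ α v v ≤ penaltyTerm κ α v v := by
  rw [weakPenaltyTerm_self hd, penaltyTerm_self, meanJumpSeminormSq, Finset.mul_sum]
  refine Finset.sum_le_sum fun e _ => ?_
  have h1 := faceCoeff_nonneg hκ e
  have h2 := e.size_nonneg
  calc α * (faceCoeff κ e * e.size⁻¹ * meanJumpSq v e)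
      = α * e.size⁻¹ * faceCoeff κ e * meanJumpSq v e := by ring
    _ ≤ _ := by
        gcongr
        exact meanJumpSq_le hd v e

theorem penaltyTerm_sub_weakPenaltyTerm_le (hd : 1 ≤ d) {σ : ℝ} (hσ : M.IsShapeRegular σ)
    {κ : M.Element → ℝ} (hκ : ∀ T, 0 < κ T) {α : ℝ} (hα : 0 ≤ α) (v : M.DGSpace) :
    penaltyTerm κ α v v - weakPenaltyTerm κ α v v ≤
      4 * α * meshConstant d σ * 2 ^ (d + 1) * diffusionTerm κ v v := by
  have hK := meshConstant_nonneg d σ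
  rw [weakPenaltyTerm_self hd, penaltyTerm_self, meanJumpSeminormSq, Finset.mul_sum,
    ← Finset.sum_sub_distrib, diffusionTerm_self]
  calc _ ≤ ∑ e : M.Face, 4 * α * meshConstant d σ * ∑ T ∈ e.neighbors, elementEnergy κ v T := by
        refine Finset.sum_le_sum fun e _ => ?_
        have h1 := faceCoeff_nonneg hκ e
        have h2 := e.size_nonneg
        calc α * e.size⁻¹ * faceCoeff κ e * (∫ x, ‖jump v e x‖ ^ 2 ∂e.measure)
              - α * (faceCoeff κ e * e.size⁻¹ * meanJumpSq v e)
            = α * e.size⁻¹ * faceCoeff κ e *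
                ((∫ x, ‖jump v e x‖ ^ 2 ∂e.measure) - meanJumpSq v e) := by ring
          _ ≤ α * e.size⁻¹ * faceCoeff κ e * (2 * e.size ^ 2 * e.measure.real Set.univ *
                ∑ T ∈ e.neighbors, ‖gradient (v T) 0‖ ^ 2) := by
              gcongr
              exact integral_jump_sq_sub_le hd v e
          _ = 2 * α * (faceCoeff κ e * ((e.size⁻¹ * e.size ^ 2) * e.measure.real Set.univ) *
                ∑ T ∈ e.neighbors, ‖gradient (v T) 0‖ ^ 2) := by ring
          _ = 2 * α * (faceCoeff κ e * (e.size * e.measure.real Set.univ) *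
                ∑ T ∈ e.neighbors, ‖gradient (v T) 0‖ ^ 2) := by
              rw [sq, mul_comm e.size⁻¹, mul_self_mul_inv]
          _ ≤ 2 * α * (2 * meshConstant d σ * ∑ T ∈ e.neighbors, elementEnergy κ v T) :=
              mul_le_mul_of_nonneg_left (faceCoeff_mul_sum_le hd hσ hκ v e) (by positivity)
          _ = _ := by ring
    _ = 4 * α * meshConstant d σ * ∑ e : M.Face, ∑ T ∈ e.neighbors, elementEnergy κ v T := by
        rw [Finset.mul_sum]
    _ ≤ 4 * α * meshConstant d σ * (2 ^ (d + 1) * ∑ T, elementEnergy κ v T) :=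
        mul_le_mul_of_nonneg_left
          (sum_faces_sum_neighbors_le _ (elementEnergy_nonneg hκ v)) (by positivity)
    _ = _ := by ring

/-- Cauchy–Schwarz and a weighted Young inequality on each face, with `δ` left free to balance
diffusion against penalty. Dividing by `h_e` requires `d ≥ 2`, as a face in dimension one is a
point. -/
theorem abs_consistencyTerm_le (hd : 2 ≤ d) {σ : ℝ} (hσ : M.IsShapeRegular σ)
    {κ : M.Element → ℝ} (hκ : ∀ T, 0 < κ T) (v : M.DGSpace) {δ : ℝ} (hδ : 0 < δ) :
    |consistencyTerm κ v v| ≤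
      2 * δ * meshConstant d σ * 2 ^ (d + 1) * diffusionTerm κ v v
        + (2 * δ)⁻¹ * meanJumpSeminormSq κ v := by
  have hd1 : 1 ≤ d := by omega
  have hK := meshConstant_nonneg d σ
  rw [consistencyTerm, meanJumpSeminormSq, diffusionTerm_self]
  calc _ ≤ ∑ e : M.Face, (2 * δ * meshConstant d σ * ∑ T ∈ e.neighbors, elementEnergy κ v T
          + (2 * δ)⁻¹ * (faceCoeff κ e * e.size⁻¹ * meanJumpSq v e)) := by
        refine Finset.abs_sum_le_sum_abs _ _ |>.trans (Finset.sum_le_sum fun e _ => ?_)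
        have h1 := faceCoeff_nonneg hκ e
        have h2 := e.size_pos hd
        set m := e.measure.real Set.univ with hm
        have hm0 : 0 ≤ m := measureReal_nonneg
        set P := ‖meanProj e (jump v e)‖ with hP
        rw [integral_fluxAverage_inner_jump hd1, abs_mul, abs_of_nonneg hm0]
        calc m * |⟪fluxAverage κ v e 0, meanProj e (jump v e)⟫|
            ≤ m * ((∑ T ∈ e.neighbors, faceCoeff κ e * ‖gradient (v T) 0‖) * P) := by
              gcongr
              exact (abs_real_inner_le_norm _ _).trans (by
                gcongr
                exact norm_fluxAverage_le hκ v e)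
          _ = ∑ T ∈ e.neighbors, m * faceCoeff κ e * (‖gradient (v T) 0‖ * P) := by
              rw [Finset.sum_mul, Finset.mul_sum]
              exact Finset.sum_congr rfl fun T _ => by ring
          _ ≤ ∑ T ∈ e.neighbors, m * faceCoeff κ e *
                (δ * e.size * ‖gradient (v T) 0‖ ^ 2 + (4 * δ * e.size)⁻¹ * P ^ 2) := by
              refine Finset.sum_le_sum fun T _ =>
                mul_le_mul_of_nonneg_left ?_ (mul_nonneg hm0 h1)
              have hs : 0 < δ * e.size := mul_pos hδ h2
              generalize ‖gradient (v T) 0‖ = a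
              -- Young's inequality `a P ≤ s a² + P² / (4 s)` with `s = δ h_e`, by completing the
              -- square.
              have : δ * e.size * a ^ 2 + (4 * δ * e.size)⁻¹ * P ^ 2 - a * P =
                  (δ * e.size) * (a - (2 * (δ * e.size))⁻¹ * P) ^ 2 := by
                field_simp
                ring
              have h0 : 0 ≤ (δ * e.size) * (a - (2 * (δ * e.size))⁻¹ * P) ^ 2 := by positivity
              linarith
          _ = δ * (faceCoeff κ e * (e.size * m) * ∑ T ∈ e.neighbors, ‖gradient (v T) 0‖ ^ 2)
                + e.neighbors.card * ((4 * δ)⁻¹ * (faceCoeff κ e * e.size⁻¹ * (m * P ^ 2))) := by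
              rw [← Finset.mul_sum, Finset.sum_add_distrib, ← Finset.mul_sum, Finset.sum_const,
                nsmul_eq_mul, mul_inv (4 * δ)]
              ring
          _ ≤ δ * (2 * meshConstant d σ * ∑ T ∈ e.neighbors, elementEnergy κ v T)
                + 2 * ((4 * δ)⁻¹ * (faceCoeff κ e * e.size⁻¹ * (m * P ^ 2))) := by
              have hc : (e.neighbors.card : ℝ) ≤ 2 := by exact_mod_cast e.card_neighbors_le_two
              exact add_le_add
                (mul_le_mul_of_nonneg_left (faceCoeff_mul_sum_le hd1 hσ hκ v e) hδ.le)
                (mul_le_mul_of_nonneg_right hc (by positivity))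
          _ = _ := by
              rw [meanJumpSq]
              field_simp
              ring
    _ = 2 * δ * meshConstant d σ * (∑ e : M.Face, ∑ T ∈ e.neighbors, elementEnergy κ v T)
          + (2 * δ)⁻¹ * ∑ e : M.Face, faceCoeff κ e * e.size⁻¹ * meanJumpSq v e := by
        rw [Finset.sum_add_distrib, ← Finset.mul_sum, ← Finset.mul_sum]
    _ ≤ 2 * δ * meshConstant d σ * (2 ^ (d + 1) * ∑ T, elementEnergy κ v T)
          + (2 * δ)⁻¹ * ∑ e : M.Face, faceCoeff κ e * e.size⁻¹ * meanJumpSq v e := by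
        gcongr
        exact sum_faces_sum_neighbors_le _ (elementEnergy_nonneg hκ v)
    _ = _ := by ring

end SimplicialMesh

end IPDG

/-! ### Coercivity and the choice of constants -/

theorem lemma2p1 (σ : ℝ) :
    ∃ α₀ : ℝ, ∀ α : ℝ, 0 < α → ∃ c₀ : ℝ, 0 < c₀ ∧
      ∀ (d : ℕ), d = 2 ∨ d = 3 →
      ∀ (Ω : Set (EuclideanSpace ℝ (Fin d))), interior (closure Ω) = Ω →
      ∀ (M : IPDG.SimplicialMesh d Ω), M.IsShapeRegular σ →
      ∀ (κ : M.Element → ℝ), (∀ T, 0 < κ T) →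
      ∀ (θ : ℝ), θ = -1 ∨ θ = 0 ∨ θ = 1 →
      ∀ (v : M.DGSpace),
        IPDG.SimplicialMesh.ipFormZero κ α θ v v ≤ IPDG.SimplicialMesh.ipForm κ α θ v v ∧
        (θ = 1 ∨ α₀ ≤ α →
          IPDG.SimplicialMesh.ipForm κ α θ v v ≤
            c₀ * IPDG.SimplicialMesh.ipFormZero κ α θ v v) := by
  -- The sum serves both dimensions, so the constants do not depend on `d`.
  set K := IPDG.SimplicialMesh.meshConstant 2 σ + IPDG.SimplicialMesh.meshConstant 3 σ
  have hK2 := IPDG.SimplicialMesh.meshConstant_nonneg 2 σ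
  have hK3 := IPDG.SimplicialMesh.meshConstant_nonneg 3 σ
  have hK : 0 ≤ K := add_nonneg hK2 hK3
  -- The threshold is `1 / δ` for the Young parameter `δ` below; `128 α K` is the gap constant `64 α
  -- K` times the coercivity constant `2`.
  refine ⟨128 * (K + 1), fun α hα => ⟨1 + 128 * α * K, by positivity, ?_⟩⟩
  intro d hd Ω _ M hσ κ hκ θ hθ v
  have hd2 : 2 ≤ d := by omega
  have hd1 : 1 ≤ d := by omega
  have hconst : IPDG.SimplicialMesh.meshConstant d σ * 2 ^ (d + 1) ≤ 16 * K := by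
    rcases hd with rfl | rfl <;> norm_num <;> linarith
  have hweak := IPDG.SimplicialMesh.weakPenaltyTerm_le_penaltyTerm hd1 hκ hα.le v
  have hgap := IPDG.SimplicialMesh.penaltyTerm_sub_weakPenaltyTerm_le hd1 hσ hκ hα.le v
  have hδ : (0 : ℝ) < (128 * (K + 1))⁻¹ := by positivity
  have hcons := IPDG.SimplicialMesh.abs_consistencyTerm_le hd2 hσ hκ v hδ
  have hW := IPDG.SimplicialMesh.meanJumpSeminormSq_nonneg hκ v
  have hD : 0 ≤ IPDG.SimplicialMesh.diffusionTerm κ v v := by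
    rw [IPDG.SimplicialMesh.diffusionTerm_self]
    exact Finset.sum_nonneg fun T _ => IPDG.SimplicialMesh.elementEnergy_nonneg hκ v T
  have hweakeq := IPDG.SimplicialMesh.weakPenaltyTerm_self hd1 κ α v
  unfold IPDG.SimplicialMesh.ipForm IPDG.SimplicialMesh.ipFormZero
  set D := IPDG.SimplicialMesh.diffusionTerm κ v v
  set C := IPDG.SimplicialMesh.consistencyTerm κ v v
  set W := IPDG.SimplicialMesh.meanJumpSeminormSq κ v
  set P := IPDG.SimplicialMesh.penaltyTerm κ α v v
  set P₀ := IPDG.SimplicialMesh.weakPenaltyTerm κ α v v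
  refine ⟨by linarith, fun h => ?_⟩
  have hgap' : P - P₀ ≤ 64 * α * K * D := by
    calc P - P₀ ≤ 4 * α * (IPDG.SimplicialMesh.meshConstant d σ * 2 ^ (d + 1)) * D := by
          linarith [hgap]
      _ ≤ 4 * α * (16 * K) * D := by gcongr
      _ = _ := by ring
  suffices hcoer : D ≤ 2 * (D - C + θ * C + P₀) by
    have := mul_le_mul_of_nonneg_left hcoer (by positivity : 0 ≤ 64 * α * K)
    linarith
  have hP₀ : 0 ≤ P₀ := by rw [hweakeq]; positivity
  by_cases hθ1 : θ = 1
  · subst hθ1; linarith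
  have hα₀ : 128 * (K + 1) ≤ α := h.resolve_left hθ1
  -- With this `δ` the diffusion coefficient is at most `32 K / (128 (K + 1)) ≤ 1/4`, and the jump
  -- coefficient `64 (K + 1)` is at most `α / 2`. This covers the worst case `θ = -1`, where the
  -- consistency term counts twice.
  have hcons' : 2 * |C| ≤ D / 2 + P₀ := by
    have h1 : 2 * (128 * (K + 1))⁻¹ * (IPDG.SimplicialMesh.meshConstant d σ * 2 ^ (d + 1)) * D
        ≤ 1 / 4 * D := by
      refine mul_le_mul_of_nonneg_right ?_ hD
      calc _ ≤ 2 * (128 * (K + 1))⁻¹ * (16 * K) := by gcongr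
        _ = 1 / 4 * (K / (K + 1)) := by field_simp; ring
        _ ≤ 1 / 4 * 1 := by
            gcongr
            exact div_le_one_of_le₀ (by linarith) (by linarith)
        _ = _ := by ring
    have h2 : (2 * (128 * (K + 1))⁻¹)⁻¹ * W ≤ P₀ / 2 := by
      rw [hweakeq, mul_inv, inv_inv]
      have := mul_le_mul_of_nonneg_right hα₀ hW
      linarith
    linarith
  have hC := neg_abs_le C
  have hC' := le_abs_self C
  rcases hθ with rfl | rfl | rfl
  · linarith
  · linarith [abs_nonneg C]
  · exact absurd rfl hθ1
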